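/- Let $k\ge 2$ and $\ell\ge 2$ be integers. For a positive integer $q$ and a tuple of integers $\mathbf h=(h_1,\dots,h_j)$ let $$A_q:=\prod_{p\nmid q}\Bigl(1-\frac1{p^k}\Bigr),\qquad A_q(\mathbf h):=\prod_{p\nmid q}\Bigl(1-\frac{u_p(\mathbf h)}{p^k}\Bigr),$$ where $p$ runs over the primes not dividing $q$ and $u_p(\mathbf h)$ is the number of distinct residue classes modulo $p^k$ among $h_1,\dots,h_j$. For real $H\ge 1$ put $B_0(H;q):=1$, $$B_j(H;q):=\int_{H-1}^{H}\ \sum_{0\le h_1<u}\cdots\sum_{0\le h_j<u}A_q(\mathbf h)\,du\quad(j\ge 1),$$ the sums being over integers, and $$C_\ell(H;q):=\sum_{j=0}^{\ell}\binom{\ell}{j}\,(-A_qH)^{\ell-j}\,B_j(H;q).$$ Then for every $\varepsilon>0$ there is a constant $K=K(\varepsilon,k,\ell)>0$ such that, for every positive integer $q$ and every real $H\ge 1$, $$|C_\ell(H;q)|\le K\,H^{\frac{\ell}{2k}+\varepsilon}.$$ -/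

import Mathlib

/-- The number `u_p(h)` of residue classes modulo `p ^ k` occupied by `h 0, …, h (j - 1)`. -/
def residueCount (k : ℕ) {j : ℕ} (h : Fin j → ℤ) (p : ℕ) : ℕ :=
  (Finset.univ.image fun i => (h i : ZMod (p ^ k))).card

/-- The singular series `∏_{p ∤ q} (1 - u_p(h) / p ^ k)` of a tuple `h` of integers: the density of
`k`-free patterns `n + q * h 0, …, n + q * h (j - 1)` among the integers `n` coprime to `q`. -/
noncomputable def singularSeries (k q : ℕ) {j : ℕ} (h : Fin j → ℤ) : ℝ :=
  ∏' p : {p : ℕ // p.Prime ∧ ¬ p ∣ q}, (1 - (residueCount k h p : ℝ) / (p : ℝ) ^ k)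

/-- `A_q = ∏_{p ∤ q} (1 - 1 / p ^ k)`: the density of the `k`-free numbers among the integers
coprime to `q`. -/
noncomputable def kfreeDensity (k q : ℕ) : ℝ :=
  ∏' p : {p : ℕ // p.Prime ∧ ¬ p ∣ q}, (1 - 1 / (p : ℝ) ^ k)

/-- `B_j(H; q)`: for `j ≥ 1`, the integral over `u ∈ [H - 1, H]` of the sum of the singular series
over all integer tuples `(h_1, …, h_j)` with `0 ≤ h_i < u`; and `B_0(H; q) = 1`.
(An integer `m` satisfies `m < u` exactly when `m < ⌈u⌉`.) -/
noncomputable def singularSum (k j q : ℕ) (H : ℝ) : ℝ :=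
  if j = 0 then 1
  else ∫ u in (H - 1)..H,
    ∑ h ∈ Fintype.piFinset (fun _ : Fin j => Finset.Ico (0 : ℤ) ⌈u⌉), singularSeries k q h

/-- `C_ℓ(H; q) = ∑_{j ≤ ℓ} binom(ℓ, j) (-A_q H) ^ (ℓ - j) B_j(H; q)`. -/
noncomputable def singularMoment (k ℓ q : ℕ) (H : ℝ) : ℝ :=
  ∑ j ∈ Finset.range (ℓ + 1),
    (ℓ.choose j : ℝ) * (-(kfreeDensity k q * H)) ^ (ℓ - j) * singularSum k j q H

/-! Fix a finite set of primes p ∤ q and, independently for each, delete one uniformly random class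
modulo p^k from the integers in [0, N). A given set of integers survives with probability ∏ (1 - u_p
/ p^k) (`sieveMean_indicator`). Hence C_ℓ, with its Euler products truncated and u frozen, is the
mean of (X - A H)^ℓ, where X counts survivors and A is the truncated density (`sieveMean_sub_pow`).
It suffices to bound the mean of (X - A N)^(2ℓ) by a constant times H^(θℓ) for a suitable θ > 1/k,
uniformly in q and in the truncation.

For this the moduli are added one at a time to the sieve of a progression of length L. A new modulus
n turns the deviation x into (1 - 1/n) x - Δ_a, where Δ_a is the excess of the deleted class among
the current survivors. Since Δ_a averages to 0 over a, only terms of order at least two in Δ_a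
matter. A class modulo n of a progression is a progression of about L/n terms, so induction on the
length controls the moments of Δ_a. If V^ℓ bounds the moment, V then grows by O((L/n)^θ), and
convergence of ∑ p^(-kθ) keeps V = O(L^θ) (`siftedMoment_le_of_sum_rpow_le`). That argument needs a
small sum; the finitely many small primes cost a constant factor each (`siftedMoment_append_le`). -/

/-! ### Averages over a random residue-class sieve. -/

/-- The average of `F` over the survivors of `T` when, for each modulus `n` of the list, the members
of one uniformly random residue class modulo `n` are removed. -/
noncomputable def sieveMean : List ℕ → (Finset ℤ → ℝ) → Finset ℤ → ℝ
  | [], F => F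
  | n :: l, F => sieveMean l fun T =>
      (∑ a ∈ Finset.Ico (0 : ℤ) n, F (T.filter fun h => h % (n : ℤ) ≠ a)) / n

theorem sieveMean_mono {l : List ℕ} {F G : Finset ℤ → ℝ} {T : Finset ℤ}
    (h : ∀ T' ⊆ T, F T' ≤ G T') : sieveMean l F T ≤ sieveMean l G T := by
  induction l generalizing F G with
  | nil => exact h T subset_rfl
  | cons n l ih =>
    refine ih fun T' hT' => ?_
    gcongr with a ha
    exact h _ ((Finset.filter_subset _ _).trans hT')

theorem sieveMean_congr {l : List ℕ} {F G : Finset ℤ → ℝ} {T : Finset ℤ}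
    (h : ∀ T' ⊆ T, F T' = G T') : sieveMean l F T = sieveMean l G T :=
  le_antisymm (sieveMean_mono fun T' hT' => (h T' hT').le)
    (sieveMean_mono fun T' hT' => (h T' hT').ge)

theorem sieveMean_add (l : List ℕ) (F G : Finset ℤ → ℝ) (T : Finset ℤ) :
    sieveMean l (fun T' => F T' + G T') T = sieveMean l F T + sieveMean l G T := by
  induction l generalizing F G with
  | nil => rfl
  | cons n l ih =>
    simp only [sieveMean, Finset.sum_add_distrib, add_div]
    exact ih _ _

theorem sieveMean_const_mul (l : List ℕ) (c : ℝ) (F : Finset ℤ → ℝ) (T : Finset ℤ) :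
    sieveMean l (fun T' => c * F T') T = c * sieveMean l F T := by
  induction l generalizing F with
  | nil => rfl
  | cons n l ih =>
    simp only [sieveMean, ← Finset.mul_sum, mul_div_assoc]
    exact ih _

theorem sieveMean_const {l : List ℕ} (hl : ∀ n ∈ l, n ≠ 0) (c : ℝ) (T : Finset ℤ) :
    sieveMean l (fun _ => c) T = c := by
  induction l with
  | nil => rfl
  | cons n l ih =>
    have hn : (n : ℝ) ≠ 0 := by exact_mod_cast hl n (by simp)
    have : (∑ _a ∈ Finset.Ico (0 : ℤ) n, c) / (n : ℝ) = c := by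
      simp
      field_simp
    simp only [sieveMean, this]
    exact ih fun n hn => hl n (by simp [hn])

theorem sieveMean_sum {ι : Type*} (l : List ℕ) (s : Finset ι) (F : ι → Finset ℤ → ℝ)
    (T : Finset ℤ) :
    sieveMean l (fun T' => ∑ i ∈ s, F i T') T = ∑ i ∈ s, sieveMean l (F i) T := by
  classical
  induction s using Finset.induction_on with
  | empty =>
    simpa using sieveMean_const_mul l 0 (fun _ => 0) T
  | insert i s hi ih =>
    simp only [Finset.sum_insert hi, sieveMean_add, ih]

/-- Used with P a residue class: the survivors of `T` in that class are the survivors of the class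
sieved by itself. -/
theorem sieveMean_filter (l : List ℕ) (F : Finset ℤ → ℝ) (T : Finset ℤ) (P : ℤ → Prop)
    [DecidablePred P] :
    sieveMean l F (T.filter P) = sieveMean l (fun T' => F (T'.filter P)) T := by
  induction l generalizing F with
  | nil => rfl
  | cons n l ih =>
    simp only [sieveMean, ih]
    congr 1
    ext T'
    simp only [Finset.filter_comm P]

/-- `B` survives the modulus `n` exactly when the deleted class is none of those it occupies, and
the choices for different moduli are independent. -/
theorem sieveMean_indicator {l : List ℕ} (hl : ∀ n ∈ l, n ≠ 0) (B T : Finset ℤ) (hB : B ⊆ T) :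
    sieveMean l (fun T' => if B ⊆ T' then 1 else 0) T =
      (l.map fun n : ℕ => 1 - ((B.image fun h => h % (n : ℤ)).card : ℝ) / n).prod := by
  induction l with
  | nil => simp [sieveMean, hB]
  | cons n l ih =>
    have hn : n ≠ 0 := hl n (by simp)
    have hn' : (n : ℝ) ≠ 0 := by exact_mod_cast hn
    have hI : (B.image fun h => h % (n : ℤ)) ⊆ Finset.Ico (0 : ℤ) n := by
      intro a ha
      obtain ⟨h, -, rfl⟩ := Finset.mem_image.1 ha
      have : (0 : ℤ) < n := by positivity
      exact Finset.mem_Ico.2 ⟨Int.emod_nonneg _ this.ne', Int.emod_lt_of_pos _ this⟩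
    have key : ∀ T' : Finset ℤ,
        (∑ a ∈ Finset.Ico (0 : ℤ) n,
          if B ⊆ T'.filter (fun h => h % (n : ℤ) ≠ a) then (1 : ℝ) else 0) / n =
        (1 - ((B.image fun h => h % (n : ℤ)).card : ℝ) / n) * if B ⊆ T' then 1 else 0 := by
      intro T'
      by_cases hT : B ⊆ T'
      · have : ∀ a : ℤ, B ⊆ T'.filter (fun h => h % (n : ℤ) ≠ a) ↔
            a ∉ B.image fun h => h % (n : ℤ) := by
          intro a
          simp only [Finset.subset_iff, Finset.mem_filter, Finset.mem_image] at hT ⊢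
          grind
        simp only [this, hT, if_true, ← Finset.sum_filter, Finset.filter_notMem_eq_sdiff,
          Finset.sum_const, nsmul_eq_mul, mul_one]
        rw [Finset.cast_card_sdiff hI]
        simp
        field_simp
      · have : ∀ a : ℤ, ¬ B ⊆ T'.filter (fun h => h % (n : ℤ) ≠ a) :=
          fun a h => hT (h.trans (Finset.filter_subset _ _))
        simp [this, hT]
    simp only [sieveMean, key, sieveMean_const_mul, List.map_cons, List.prod_cons]
    rw [ih fun n hn => hl n (by simp [hn])]

/-! ### Inequalities for even powers. -/

/-- The term linear in `y` is kept exactly, because it will average to zero; all higher terms are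
dominated by the two extreme ones, with binomial coefficients summing to at most 2^(2r+2). -/
theorem add_pow_even_le (r : ℕ) (x y : ℝ) :
    (x + y) ^ (2 * r + 2) ≤ x ^ (2 * r + 2) + (2 * r + 2) * x ^ (2 * r + 1) * y +
      4 ^ (r + 1) * (x ^ (2 * r) * y ^ 2 + y ^ (2 * r + 2)) := by
  rw [add_comm x y, add_pow, Finset.sum_range_succ', Finset.sum_range_succ']
  have h : ∀ j ∈ Finset.range (2 * r + 1),
      y ^ (j + 1 + 1) * x ^ (2 * r + 2 - (j + 1 + 1)) * ((2 * r + 2).choose (j + 1 + 1) : ℝ) ≤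
        (x ^ (2 * r) * y ^ 2 + y ^ (2 * r + 2)) * ((2 * r + 2).choose (j + 1 + 1) : ℝ) := by
    intro j hj
    gcongr
    have hj : j ≤ 2 * r := by simpa [Nat.lt_succ_iff] using hj
    have hM : |y| ^ j * |x| ^ (2 * r - j) ≤ |x| ^ (2 * r) + |y| ^ (2 * r) := by
      have h1 : |y| ^ j * |x| ^ (2 * r - j) ≤ max |x| |y| ^ j * max |x| |y| ^ (2 * r - j) := by
        gcongr <;> simp
      rw [← pow_add, Nat.add_sub_cancel' hj] at h1
      refine h1.trans ?_
      rcases max_choice |x| |y| with h | h <;> rw [h] <;> simp [pow_nonneg]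
    rw [(even_two_mul r).pow_abs, (even_two_mul r).pow_abs] at hM
    have h2 : y ^ (j + 1 + 1) * x ^ (2 * r + 2 - (j + 1 + 1)) =
        y ^ 2 * (y ^ j * x ^ (2 * r - j)) := by
      rw [show 2 * r + 2 - (j + 1 + 1) = 2 * r - j by omega]; ring
    have h3 : y ^ j * x ^ (2 * r - j) ≤ x ^ (2 * r) + y ^ (2 * r) := by
      refine (le_abs_self _).trans ?_
      rwa [abs_mul, abs_pow, abs_pow]
    rw [h2]
    calc _ ≤ y ^ 2 * (x ^ (2 * r) + y ^ (2 * r)) := by gcongr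
      _ = _ := by ring
  have h4 : (∑ j ∈ Finset.range (2 * r + 1), ((2 * r + 2).choose (j + 1 + 1) : ℝ)) ≤
      4 ^ (r + 1) := by
    have h5 : (∑ j ∈ Finset.range (2 * r + 2 + 1), ((2 * r + 2).choose j : ℝ)) =
        2 ^ (2 * r + 2) := by exact_mod_cast Nat.sum_range_choose (2 * r + 2)
    rw [Finset.sum_range_succ', Finset.sum_range_succ'] at h5
    have h6 : (2 : ℝ) ^ (2 * r + 2) = 4 ^ (r + 1) := by
      rw [show 2 * r + 2 = 2 * (r + 1) by ring, pow_mul]; norm_num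
    rw [← h6, ← h5]
    have : (0 : ℝ) ≤ ((2 * r + 2).choose (0 + 1) : ℝ) := by positivity
    have : (0 : ℝ) ≤ ((2 * r + 2).choose 0 : ℝ) := by positivity
    linarith
  have h7 := Finset.sum_le_sum h
  rw [← Finset.mul_sum] at h7
  have h8 : 0 ≤ x ^ (2 * r) * y ^ 2 + y ^ (2 * r + 2) := by
    have := (even_two_mul r).pow_nonneg x
    have := (even_two_mul (r + 1)).pow_nonneg y
    rw [mul_add, mul_one] at this
    positivity
  have h9 := mul_le_mul_of_nonneg_left h4 h8
  simp only [zero_add, pow_one, pow_zero, one_mul, Nat.choose_one_right, Nat.choose_zero_right,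
    Nat.cast_one, mul_one, Nat.sub_zero]
  rw [show 2 * r + 2 - 1 = 2 * r + 1 by omega]
  push_cast at h7 h9 ⊢
  nlinarith

theorem even_pow_add_le (r : ℕ) (x y : ℝ) :
    (x + y) ^ (2 * r + 2) ≤ 4 ^ (r + 1) * (x ^ (2 * r + 2) + y ^ (2 * r + 2)) := by
  have h1 : |x + y| ≤ 2 * max |x| |y| := by
    have := abs_add_le x y
    have := le_max_left |x| |y|
    have := le_max_right |x| |y|
    linarith
  have he : Even (2 * r + 2) := ⟨r + 1, by ring⟩
  have h2 := pow_le_pow_left₀ (abs_nonneg _) h1 (2 * r + 2)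
  rw [he.pow_abs, mul_pow, show (2 : ℝ) ^ (2 * r + 2) = 4 ^ (r + 1) by
      rw [show 2 * r + 2 = 2 * (r + 1) by ring, pow_mul]; norm_num] at h2
  refine h2.trans (mul_le_mul_of_nonneg_left ?_ (by positivity))
  have := he.pow_nonneg x
  have := he.pow_nonneg y
  rcases max_choice |x| |y| with h | h <;> rw [h, he.pow_abs] <;> linarith

theorem even_pow_add_add_le (r : ℕ) (x y z : ℝ) :
    (x + y + z) ^ (2 * r + 2) ≤
      9 ^ (r + 1) * (x ^ (2 * r + 2) + y ^ (2 * r + 2) + z ^ (2 * r + 2)) := by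
  have h1 : |x + y + z| ≤ 3 * max (max |x| |y|) |z| := by
    have := abs_add_three x y z
    have := le_max_left |x| |y|
    have := le_max_right |x| |y|
    have := le_max_left (max |x| |y|) |z|
    have := le_max_right (max |x| |y|) |z|
    linarith
  have he : Even (2 * r + 2) := ⟨r + 1, by ring⟩
  have h2 := pow_le_pow_left₀ (abs_nonneg _) h1 (2 * r + 2)
  rw [he.pow_abs, mul_pow, show (3 : ℝ) ^ (2 * r + 2) = 9 ^ (r + 1) by
      rw [show 2 * r + 2 = 2 * (r + 1) by ring, pow_mul]; norm_num] at h2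
  refine h2.trans (mul_le_mul_of_nonneg_left ?_ (by positivity))
  have := he.pow_nonneg x
  have := he.pow_nonneg y
  have := he.pow_nonneg z
  rcases max_choice (max |x| |y|) |z| with h | h
  · rw [h]
    rcases max_choice |x| |y| with h | h <;> rw [h, he.pow_abs] <;> linarith
  · rw [h, he.pow_abs]; linarith

/-- A weighted Young inequality, balanced so that both terms are s V^r when X = V and Y = s. -/
theorem mul_le_weighted_pow (r : ℕ) {X Y s V : ℝ} (hX : 0 ≤ X) (hY : 0 ≤ Y) (hs : 0 < s)
    (hV : 0 < V) : X ^ r * Y ≤ s / V * X ^ (r + 1) + (V / s) ^ r * Y ^ (r + 1) := by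
  rcases le_total Y (s / V * X) with h | h
  · calc X ^ r * Y ≤ X ^ r * (s / V * X) := by gcongr
      _ = s / V * X ^ (r + 1) := by ring
      _ ≤ _ := le_add_of_nonneg_right (by positivity)
  · have h' : X ≤ V / s * Y := by
      rw [div_mul_eq_mul_div, le_div_iff₀ hs]
      rw [div_mul_eq_mul_div, div_le_iff₀ hV] at h
      linarith
    calc X ^ r * Y ≤ (V / s * Y) ^ r * Y := by gcongr
      _ = (V / s) ^ r * Y ^ (r + 1) := by ring
      _ ≤ _ := le_add_of_nonneg_left (by positivity)

theorem pow_le_weighted_pow_succ (r : ℕ) {X V : ℝ} (hX : 0 ≤ X) (hV : 0 < V) :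
    X ^ r ≤ X ^ (r + 1) / V + V ^ r := by
  rcases le_total X V with h | h
  · calc X ^ r ≤ V ^ r := by gcongr
      _ ≤ _ := le_add_of_nonneg_left (by positivity)
  · calc X ^ r = X ^ r * V / V := by field_simp
      _ ≤ X ^ r * X / V := by gcongr
      _ = X ^ (r + 1) / V := by ring
      _ ≤ _ := le_add_of_nonneg_right (by positivity)

theorem pow_succ_add_mul_le (r : ℕ) {V c : ℝ} (hV : 0 ≤ V) (hc : 0 ≤ c) :
    V ^ (r + 1) + c * V ^ r ≤ (V + c) ^ (r + 1) := by
  calc V ^ (r + 1) + c * V ^ r = V ^ r * (V + c) := by ring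
    _ ≤ (V + c) ^ r * (V + c) := by gcongr; linarith
    _ = _ := by ring

/-- Adding a centred increment, averaged over its values. -/
theorem mean_even_pow_le {ι : Type*} (I : Finset ι) (Δ : ι → ℝ) (hΔ : ∑ a ∈ I, Δ a = 0) {n : ℝ}
    (hn : 0 < n) (hI : (I.card : ℝ) = n) (r : ℕ) {α : ℝ} (hα : 0 ≤ α) (hα' : α ≤ 1) (x : ℝ) :
    (∑ a ∈ I, (α * x - Δ a) ^ (2 * r + 2)) / n ≤ x ^ (2 * r + 2) +
      4 ^ (r + 1) * (x ^ (2 * r) * ((∑ a ∈ I, Δ a ^ 2) / n) + (∑ a ∈ I, Δ a ^ (2 * r + 2)) / n) := by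
  have h1 : ∀ a ∈ I, (α * x - Δ a) ^ (2 * r + 2) ≤ x ^ (2 * r + 2) +
      (2 * r + 2) * (α * x) ^ (2 * r + 1) * (-Δ a) +
      4 ^ (r + 1) * (x ^ (2 * r) * Δ a ^ 2 + Δ a ^ (2 * r + 2)) := by
    intro a _
    have h := add_pow_even_le r (α * x) (-Δ a)
    have he : Even (2 * r + 2) := ⟨r + 1, by ring⟩
    rw [← sub_eq_add_neg, neg_sq, he.neg_pow] at h
    refine h.trans ?_
    gcongr ?_ + _ + _ * (?_ * _ + _)
    · rw [mul_pow]
      exact mul_le_of_le_one_left (he.pow_nonneg x) (pow_le_one₀ hα hα')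
    · rw [mul_pow]
      exact mul_le_of_le_one_left ((even_two_mul r).pow_nonneg x) (pow_le_one₀ hα hα')
  have h2 := Finset.sum_le_sum h1
  rw [Finset.sum_add_distrib, Finset.sum_add_distrib, ← Finset.mul_sum, ← Finset.mul_sum,
    Finset.sum_neg_distrib, hΔ, Finset.sum_add_distrib, ← Finset.mul_sum, Finset.sum_const,
    nsmul_eq_mul, hI] at h2
  rw [div_le_iff₀ hn]
  refine h2.trans (le_of_eq ?_)
  field_simp
  ring

/-! ### Central moments and the effect of one more modulus. -/

/-- The expected proportion of survivors of a sieve by the moduli of the list. -/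
noncomputable def sieveDensity (l : List ℕ) : ℝ := (l.map fun n : ℕ => 1 - 1 / (n : ℝ)).prod

theorem sieveDensity_mem (l : List ℕ) : 0 ≤ sieveDensity l ∧ sieveDensity l ≤ 1 := by
  induction l with
  | nil => simp [sieveDensity]
  | cons n l ih =>
    have h : 1 / (n : ℝ) ≤ 1 := by
      rcases Nat.eq_zero_or_pos n with rfl | hn
      · simp
      · rw [div_le_one (by positivity)]; exact_mod_cast hn
    have h' : 0 ≤ 1 / (n : ℝ) := by positivity
    simp only [sieveDensity, List.map_cons, List.prod_cons] at ih ⊢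
    exact ⟨mul_nonneg (by linarith) ih.1, mul_le_one₀ (by linarith) ih.1 ih.2⟩

/-- The central moment of order `2 * r + 2` of the number of survivors of `T`. -/
noncomputable def siftedMoment (r : ℕ) (l : List ℕ) (T : Finset ℤ) : ℝ :=
  sieveMean l (fun T' => ((T'.card : ℝ) - sieveDensity l * T.card) ^ (2 * r + 2)) T

theorem even_two_mul_add_two (r : ℕ) : Even (2 * r + 2) := ⟨r + 1, by ring⟩

theorem siftedMoment_empty {r : ℕ} {l : List ℕ} (hl : ∀ n ∈ l, n ≠ 0) :
    siftedMoment r l ∅ = 0 := by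
  rw [← sieveMean_const hl 0 ∅]
  refine sieveMean_congr fun T' hT' => ?_
  simp [Finset.subset_empty.1 hT']

/-- The excess of the residue class `a` modulo `n` among the elements of `T`. -/
noncomputable def classExcess (n : ℕ) (T : Finset ℤ) (a : ℤ) : ℝ :=
  ((T.filter fun h => h % (n : ℤ) = a).card : ℝ) - (T.card : ℝ) / n

theorem sum_card_class {n : ℕ} (hn : n ≠ 0) (T : Finset ℤ) :
    ∑ a ∈ Finset.Ico (0 : ℤ) n, ((T.filter fun h => h % (n : ℤ) = a).card : ℝ) = T.card := by
  have hn' : (0 : ℤ) < n := by positivity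
  rw [Finset.card_eq_sum_card_fiberwise (f := fun h => h % (n : ℤ)) (t := Finset.Ico (0 : ℤ) n)]
  · push_cast; rfl
  · intro h _
    simpa using ⟨Int.emod_nonneg _ hn'.ne', Int.emod_lt_of_pos _ hn'⟩

theorem sum_classExcess {n : ℕ} (hn : n ≠ 0) (T : Finset ℤ) :
    ∑ a ∈ Finset.Ico (0 : ℤ) n, classExcess n T a = 0 := by
  have hn' : (n : ℝ) ≠ 0 := by exact_mod_cast hn
  simp only [classExcess, Finset.sum_sub_distrib, sum_card_class hn]
  simp
  field_simp
  ring

/-- The head of the list is sieved last: `T'` is what `l` leaves, and deleting class `a` shrinks the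
old deviation by 1 - 1/n and subtracts the excess. -/
theorem siftedMoment_cons (r n : ℕ) (l : List ℕ) (T : Finset ℤ) :
    siftedMoment r (n :: l) T = sieveMean l (fun T' => (∑ a ∈ Finset.Ico (0 : ℤ) n,
      ((1 - 1 / (n : ℝ)) * ((T'.card : ℝ) - sieveDensity l * T.card) -
        classExcess n T' a) ^ (2 * r + 2)) / n) T := by
  unfold siftedMoment
  simp only [sieveMean]
  congr 1
  ext T'
  congr 1
  refine Finset.sum_congr rfl fun a _ => ?_
  congr 1
  have h := Finset.card_filter_add_card_filter_not (s := T') fun h => h % (n : ℤ) = a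
  have h' : ((T'.filter fun h => h % (n : ℤ) = a).card : ℝ) +
    (T'.filter fun h => h % (n : ℤ) ≠ a).card = T'.card := by exact_mod_cast h
  simp only [classExcess, sieveDensity, List.map_cons, List.prod_cons]
  linear_combination h'

theorem one_sub_one_div_mem {n : ℕ} (hn : n ≠ 0) : 0 ≤ 1 - 1 / (n : ℝ) ∧ 1 - 1 / (n : ℝ) ≤ 1 := by
  have : (1 : ℝ) ≤ n := by exact_mod_cast Nat.one_le_iff_ne_zero.2 hn
  have h1 : 1 / (n : ℝ) ≤ 1 := by rw [div_le_one (by positivity)]; exact this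
  have h2 : 0 ≤ 1 / (n : ℝ) := by positivity
  constructor <;> linarith

/-- The mean over the classes modulo `n` of an even power of the excess among the survivors. -/
noncomputable def excessMoment (r n : ℕ) (l : List ℕ) (T : Finset ℤ) : ℝ :=
  sieveMean l (fun T' => (∑ a ∈ Finset.Ico (0 : ℤ) n, classExcess n T' a ^ (2 * r + 2)) / n) T

/-- The excess splits into the centred survivor count of the class, minus the mean of these counts
over all classes (controlled by Jensen), plus the unevenness of `T` itself, which is at most 1. -/
theorem excessMoment_le {r n : ℕ} (hn : n ≠ 0) {l : List ℕ} (hl : ∀ m ∈ l, m ≠ 0) {T : Finset ℤ}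
    (hT : ∀ a ∈ Finset.Ico (0 : ℤ) n,
      |((T.filter fun h => h % (n : ℤ) = a).card : ℝ) - (T.card : ℝ) / n| ≤ 1) {B : ℝ}
    (hB : ∀ a ∈ Finset.Ico (0 : ℤ) n,
      siftedMoment r l (T.filter fun h => h % (n : ℤ) = a) ≤ B) :
    excessMoment r n l T ≤ 9 ^ (r + 1) * (2 * B + 1) := by
  have hn' : (0 : ℝ) < n := by positivity
  set I := Finset.Ico (0 : ℤ) n with hI
  have hcard : (I.card : ℝ) = n := by simp [hI]
  set w : ℤ → Finset ℤ → ℝ := fun a T' => ((T'.filter fun h => h % (n : ℤ) = a).card : ℝ) -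
    sieveDensity l * (T.filter fun h => h % (n : ℤ) = a).card with hw
  have he := even_two_mul_add_two r
  have h1 : ∀ T' ⊆ T, (∑ a ∈ I, classExcess n T' a ^ (2 * r + 2)) / n ≤
      9 ^ (r + 1) * (2 / n) * (∑ a ∈ I, w a T' ^ (2 * r + 2)) + 9 ^ (r + 1) := by
    intro T' _
    set μ := (∑ a ∈ I, w a T') / n with hμ
    have hμ' : μ = (T'.card : ℝ) / n - sieveDensity l * (T.card / n) := by
      rw [hμ, hw]
      simp only [Finset.sum_sub_distrib, ← Finset.mul_sum, hI, sum_card_class hn]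
      ring
    have hJ : μ ^ (2 * r + 2) ≤ (∑ a ∈ I, w a T' ^ (2 * r + 2)) / n := by
      have := Real.pow_arith_mean_le_arith_mean_pow_of_even I (fun _ => 1 / (n : ℝ))
        (fun a => w a T') (fun _ _ => by positivity) (by simp [hcard]; field_simp) he
      simp only [one_div_mul_eq_div, ← Finset.sum_div] at this
      exact this
    have h2 : ∀ a ∈ I, classExcess n T' a ^ (2 * r + 2) ≤
        9 ^ (r + 1) * (w a T' ^ (2 * r + 2) + μ ^ (2 * r + 2) + 1) := by
      intro a ha
      have h3 : classExcess n T' a = w a T' + (-μ) + sieveDensity l *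
          (((T.filter fun h => h % (n : ℤ) = a).card : ℝ) - (T.card : ℝ) / n) := by
        rw [hμ', classExcess, hw]; ring
      rw [h3]
      refine (even_pow_add_add_le r _ _ _).trans ?_
      rw [he.neg_pow μ]
      gcongr
      rw [← he.pow_abs]
      refine pow_le_one₀ (abs_nonneg _) ?_
      rw [abs_mul, abs_of_nonneg (sieveDensity_mem l).1]
      exact mul_le_one₀ (sieveDensity_mem l).2 (abs_nonneg _) (hT a ha)
    calc _ ≤ (∑ a ∈ I, 9 ^ (r + 1) * (w a T' ^ (2 * r + 2) + μ ^ (2 * r + 2) + 1)) / n := by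
          gcongr with a ha; exact h2 a ha
      _ = 9 ^ (r + 1) * ((∑ a ∈ I, w a T' ^ (2 * r + 2)) / n + μ ^ (2 * r + 2) + 1) := by
          rw [← Finset.mul_sum, Finset.sum_add_distrib, Finset.sum_add_distrib]
          simp only [Finset.sum_const, nsmul_eq_mul, hcard]
          field_simp
      _ ≤ 9 ^ (r + 1) * ((∑ a ∈ I, w a T' ^ (2 * r + 2)) / n +
            (∑ a ∈ I, w a T' ^ (2 * r + 2)) / n + 1) := by gcongr
      _ = _ := by ring
  refine (sieveMean_mono h1).trans ?_
  rw [sieveMean_add, sieveMean_const_mul, sieveMean_const hl, sieveMean_sum]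
  have h4 : ∀ a ∈ I, sieveMean l (fun T' => w a T' ^ (2 * r + 2)) T ≤ B := by
    intro a ha
    refine le_trans (le_of_eq ?_) (hB a ha)
    rw [siftedMoment, sieveMean_filter]
  have h5 := Finset.sum_le_sum h4
  rw [Finset.sum_const, nsmul_eq_mul, hcard] at h5
  calc _ ≤ 9 ^ (r + 1) * (2 / n) * (n * B) + 9 ^ (r + 1) := by gcongr
    _ = _ := by field_simp

/-- Ignores the cancellation and loses a constant factor, which is affordable for boundedly many
moduli. -/
theorem siftedMoment_cons_le_crude {r n : ℕ} (hn : n ≠ 0) {l : List ℕ} (T : Finset ℤ) :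
    siftedMoment r (n :: l) T ≤ 4 ^ (r + 1) * (siftedMoment r l T + excessMoment r n l T) := by
  have hn' : (0 : ℝ) < n := by positivity
  have he := even_two_mul_add_two r
  rw [siftedMoment_cons, siftedMoment, excessMoment, ← sieveMean_add, ← sieveMean_const_mul]
  refine sieveMean_mono fun T' _ => ?_
  set x := (T'.card : ℝ) - sieveDensity l * T.card
  have h1 : ∀ a ∈ Finset.Ico (0 : ℤ) n,
      ((1 - 1 / (n : ℝ)) * x - classExcess n T' a) ^ (2 * r + 2) ≤
        4 ^ (r + 1) * (x ^ (2 * r + 2) + classExcess n T' a ^ (2 * r + 2)) := by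
    intro a _
    rw [sub_eq_add_neg]
    refine (even_pow_add_le r _ _).trans ?_
    rw [he.neg_pow, mul_pow]
    gcongr
    obtain ⟨h2, h3⟩ := one_sub_one_div_mem hn
    exact mul_le_of_le_one_left (he.pow_nonneg x) (pow_le_one₀ h2 h3)
  rw [div_le_iff₀ hn']
  refine (Finset.sum_le_sum h1).trans (le_of_eq ?_)
  rw [← Finset.mul_sum, Finset.sum_add_distrib]
  simp
  field_simp

theorem siftedMoment_cons_le {r n : ℕ} (hn : n ≠ 0) {l : List ℕ} (T : Finset ℤ) :
    siftedMoment r (n :: l) T ≤ siftedMoment r l T + 4 ^ (r + 1) *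
      (sieveMean l (fun T' => ((T'.card : ℝ) - sieveDensity l * T.card) ^ (2 * r) *
        ((∑ a ∈ Finset.Ico (0 : ℤ) n, classExcess n T' a ^ 2) / n)) T + excessMoment r n l T) := by
  rw [siftedMoment_cons, siftedMoment, excessMoment, ← sieveMean_add, ← sieveMean_const_mul,
    ← sieveMean_add]
  refine sieveMean_mono fun T' _ => ?_
  obtain ⟨h2, h3⟩ := one_sub_one_div_mem hn
  exact mean_even_pow_le _ _ (sum_classExcess hn T') (by positivity) (by simp) r h2 h3 _

/-- Adding a modulus whose excess has a moment of size `s ^ (r + 1)`. -/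
theorem siftedMoment_cons_le_of_excessMoment {r n : ℕ} (hn : n ≠ 0) {l : List ℕ} {T : Finset ℤ}
    {V s : ℝ} (hs : 0 < s) (hsV : s ≤ V) (hV : siftedMoment r l T ≤ V ^ (r + 1))
    (hE : excessMoment r n l T ≤ s ^ (r + 1)) :
    siftedMoment r (n :: l) T ≤ (V + 3 * 4 ^ (r + 1) * s) ^ (r + 1) := by
  have hV0 : 0 < V := hs.trans_le hsV
  have hn' : (0 : ℝ) < n := by positivity
  have h1 : sieveMean l (fun T' => ((T'.card : ℝ) - sieveDensity l * T.card) ^ (2 * r) *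
      ((∑ a ∈ Finset.Ico (0 : ℤ) n, classExcess n T' a ^ 2) / n)) T ≤
      s / V * siftedMoment r l T + (V / s) ^ r * excessMoment r n l T := by
    rw [siftedMoment, excessMoment, ← sieveMean_const_mul, ← sieveMean_const_mul, ← sieveMean_add]
    refine sieveMean_mono fun T' _ => ?_
    set x := (T'.card : ℝ) - sieveDensity l * T.card
    have h2 : ∀ a ∈ Finset.Ico (0 : ℤ) n, x ^ (2 * r) * classExcess n T' a ^ 2 ≤
        s / V * x ^ (2 * r + 2) + (V / s) ^ r * classExcess n T' a ^ (2 * r + 2) := by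
      intro a _
      have := mul_le_weighted_pow r (sq_nonneg x) (sq_nonneg (classExcess n T' a)) hs hV0
      simpa only [← pow_mul, mul_add, mul_one] using this
    have h3 := Finset.sum_le_sum h2
    rw [← Finset.mul_sum, Finset.sum_add_distrib, ← Finset.mul_sum, ← Finset.mul_sum] at h3
    simp only [Finset.sum_const, Int.card_Ico, sub_zero, Int.toNat_natCast, nsmul_eq_mul] at h3
    rw [← mul_div_assoc, div_le_iff₀ hn']
    refine h3.trans (le_of_eq ?_)
    field_simp
  have h2 : s / V * siftedMoment r l T + (V / s) ^ r * excessMoment r n l T ≤ 2 * s * V ^ r := by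
    calc _ ≤ s / V * V ^ (r + 1) + (V / s) ^ r * s ^ (r + 1) := by gcongr
      _ = _ := by rw [div_pow]; field_simp; ring
  have h3 : excessMoment r n l T ≤ s * V ^ r := by
    refine hE.trans ?_
    rw [pow_succ, mul_comm]
    gcongr
  refine (siftedMoment_cons_le hn T).trans ?_
  refine le_trans ?_ (pow_succ_add_mul_le r hV0.le (c := 3 * 4 ^ (r + 1) * s) (by positivity))
  calc _ ≤ V ^ (r + 1) + 4 ^ (r + 1) * (2 * s * V ^ r + s * V ^ r) := by
        gcongr; exact h1.trans h2
    _ = _ := by ring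

/-- Adding a modulus each of whose classes meets `T` at most once. -/
theorem siftedMoment_cons_le_of_card_le_one {r n : ℕ} (hn : n ≠ 0) {l : List ℕ}
    (hl : ∀ m ∈ l, m ≠ 0) {T : Finset ℤ}
    (hT : ∀ a ∈ Finset.Ico (0 : ℤ) n, (T.filter fun h => h % (n : ℤ) = a).card ≤ 1) (hTn : T.card ≤ n)
    {V s : ℝ} (hV1 : 1 ≤ V) (hs : (T.card : ℝ) / n ≤ s) (hV : siftedMoment r l T ≤ V ^ (r + 1)) :
    siftedMoment r (n :: l) T ≤ (V + 3 * 4 ^ (r + 1) * s) ^ (r + 1) := by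
  have hV0 : 0 < V := by linarith
  have hn' : (0 : ℝ) < n := by positivity
  have hs0 : 0 ≤ s := le_trans (by positivity) hs
  have h1 : ∀ T' ⊆ T, (∑ a ∈ Finset.Ico (0 : ℤ) n, classExcess n T' a ^ 2) / n ≤ s := by
    intro T' hT'
    refine le_trans ?_ hs
    gcongr
    -- Each class count is 0 or 1, hence equal to its square.
    have h2 : ∀ a ∈ Finset.Ico (0 : ℤ) n, classExcess n T' a ^ 2 ≤
        ((T'.filter fun h => h % (n : ℤ) = a).card : ℝ) - 2 * (T'.card / n) *
          (T'.filter fun h => h % (n : ℤ) = a).card + (T'.card / n) ^ 2 := by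
      intro a ha
      have h3 : (T'.filter fun h => h % (n : ℤ) = a).card ≤ 1 :=
        (Finset.card_le_card (Finset.filter_subset_filter _ hT')).trans (hT a ha)
      rw [classExcess]
      interval_cases (T'.filter fun h => h % (n : ℤ) = a).card <;> push_cast <;> nlinarith
    refine (Finset.sum_le_sum h2).trans ?_
    rw [Finset.sum_add_distrib, Finset.sum_sub_distrib, ← Finset.mul_sum, sum_card_class hn]
    simp only [Finset.sum_const, Int.card_Ico, sub_zero, Int.toNat_natCast, nsmul_eq_mul]
    have h4 : (T'.card : ℝ) ≤ T.card := by exact_mod_cast Finset.card_le_card hT'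
    have h5 : 0 ≤ (T'.card : ℝ) ^ 2 / n := by positivity
    calc _ = (T'.card : ℝ) - (T'.card : ℝ) ^ 2 / n := by field_simp; ring
      _ ≤ _ := by linarith
  have h2 : excessMoment r n l T ≤ s := by
    rw [← sieveMean_const hl s T]
    refine sieveMean_mono fun T' hT' => le_trans ?_ (h1 T' hT')
    refine div_le_div_of_nonneg_right (Finset.sum_le_sum fun a ha => ?_) hn'.le
    have h3 : (T'.filter fun h => h % (n : ℤ) = a).card ≤ 1 :=
      (Finset.card_le_card (Finset.filter_subset_filter _ hT')).trans (hT a ha)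
    have h3' : ((T'.filter fun h => h % (n : ℤ) = a).card : ℝ) ≤ 1 := by exact_mod_cast h3
    have h4 : (T'.card : ℝ) / n ≤ 1 := by
      rw [div_le_one hn']
      exact_mod_cast (Finset.card_le_card hT').trans hTn
    have h5 : (0 : ℝ) ≤ (T'.card : ℝ) / n := by positivity
    have h6 : |classExcess n T' a| ≤ 1 := by
      rw [classExcess, abs_le]
      constructor <;> linarith [Nat.cast_nonneg (α := ℝ)
        (T'.filter fun h => h % (n : ℤ) = a).card]
    rw [← (even_two_mul_add_two r).pow_abs, ← sq_abs]
    exact pow_le_pow_of_le_one (abs_nonneg _) h6 (by omega)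
  have h3 : sieveMean l (fun T' => ((T'.card : ℝ) - sieveDensity l * T.card) ^ (2 * r) *
      ((∑ a ∈ Finset.Ico (0 : ℤ) n, classExcess n T' a ^ 2) / n)) T ≤
      s / V * siftedMoment r l T + s * V ^ r := by
    rw [siftedMoment, ← sieveMean_const_mul, ← sieveMean_const hl (s * V ^ r) T, ← sieveMean_add]
    refine sieveMean_mono fun T' hT' => ?_
    set x := (T'.card : ℝ) - sieveDensity l * T.card
    have h4 := pow_le_weighted_pow_succ r (sq_nonneg x) hV0
    simp only [← pow_mul, mul_add, mul_one] at h4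
    have h5 := (even_two_mul r).pow_nonneg x
    calc _ ≤ x ^ (2 * r) * s := by gcongr; exact h1 T' hT'
      _ ≤ (x ^ (2 * r + 2) / V + V ^ r) * s := by gcongr
      _ = _ := by ring
  have h4 : s / V * siftedMoment r l T ≤ s * V ^ r := by
    calc _ ≤ s / V * V ^ (r + 1) := by gcongr
      _ = _ := by field_simp; ring
  have h5 : s ≤ s * V ^ r := le_mul_of_one_le_right hs0 (one_le_pow₀ hV1)
  refine (siftedMoment_cons_le hn T).trans ?_
  refine le_trans ?_ (pow_succ_add_mul_le r hV0.le (c := 3 * 4 ^ (r + 1) * s) (by positivity))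
  calc _ ≤ V ^ (r + 1) + 4 ^ (r + 1) * ((s * V ^ r + s * V ^ r) + s * V ^ r) := by
        gcongr
        · exact h3.trans (by linarith)
        · exact h2.trans h5
    _ = _ := by ring

/-! ### Residue classes of arithmetic progressions. -/

/-- `T` is a finite arithmetic progression of integers with difference `d`. -/
def IsProgression (d : ℕ) (T : Finset ℤ) : Prop :=
  ∃ (c : ℤ) (L : ℕ), T = (Finset.range L).image fun t : ℕ => c + d * t

theorem card_progression {d : ℕ} (hd : d ≠ 0) (c : ℤ) (L : ℕ) :
    ((Finset.range L).image fun t : ℕ => c + (d : ℤ) * t).card = L := by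
  rw [Finset.card_image_of_injective, Finset.card_range]
  intro s t h
  simpa [hd] using h

/-- As d is invertible modulo n, the class selects the indices t ≡ t₀ (mod n) for one t₀ in [0, n).
-/
theorem IsProgression.filter {d n : ℕ} (hd : d ≠ 0) (hn : n ≠ 0) (hdn : d.Coprime n)
    {T : Finset ℤ} (hT : IsProgression d T) {a : ℤ} (ha : a ∈ Finset.Ico (0 : ℤ) n) :
    IsProgression (d * n) (T.filter fun h => h % (n : ℤ) = a) ∧
      |((T.filter fun h => h % (n : ℤ) = a).card : ℝ) - (T.card : ℝ) / n| ≤ 1 ∧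
      ((T.filter fun h => h % (n : ℤ) = a).card : ℝ) < (T.card : ℝ) / n + 1 := by
  obtain ⟨c, L, rfl⟩ := hT
  have hn0 : (0 : ℤ) < n := by positivity
  rw [Finset.mem_Ico] at ha
  have hco : IsCoprime (d : ℤ) n := Nat.isCoprime_iff_coprime.2 hdn
  obtain ⟨x, y, hxy⟩ := id hco
  obtain ⟨t₀, ht₀⟩ : ∃ t₀ : ℕ, (t₀ : ℤ) = ((a - c) * x) % n :=
    ⟨(((a - c) * x) % n).toNat, Int.toNat_of_nonneg (Int.emod_nonneg _ hn0.ne')⟩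
  have ht₀n : t₀ < n := by
    have := Int.emod_lt_of_pos ((a - c) * x) hn0
    rw [← ht₀] at this
    exact_mod_cast this
  have hdvd : (n : ℤ) ∣ c + d * t₀ - a := by
    refine ⟨-(a - c) * y - d * (((a - c) * x) / n), ?_⟩
    have := Int.emod_add_mul_ediv ((a - c) * x) n
    rw [← ht₀] at this
    linear_combination (d : ℤ) * this + (a - c) * hxy
  have hmem : ∀ t : ℕ, (c + (d : ℤ) * t) % n = a ↔ (n : ℤ) ∣ t - t₀ := by
    intro t
    have h1 : (c + (d : ℤ) * t) % n = a ↔ (n : ℤ) ∣ c + d * t - a := by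
      rw [← Int.emod_eq_emod_iff_emod_sub_eq_zero.trans (Int.dvd_iff_emod_eq_zero).symm,
        Int.emod_eq_of_lt ha.1 ha.2]
    rw [h1, ← dvd_sub_left hdvd, show c + (d : ℤ) * t - a - (c + d * t₀ - a) = d * (t - t₀) by ring]
    exact ⟨fun h => hco.symm.dvd_of_dvd_mul_left h, fun h => h.mul_left _⟩
  -- The number of s ≥ 0 with t₀ + n s < L, as a rounded-up quotient.
  obtain ⟨L', hL'⟩ : ∃ L', L' = (L + (n - 1 - t₀)) / n := ⟨_, rfl⟩
  have hlt : ∀ s : ℕ, s < L' ↔ t₀ + n * s < L := by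
    intro s
    rw [hL', ← Nat.succ_le_iff, Nat.le_div_iff_mul_le (Nat.pos_of_ne_zero hn), Nat.succ_mul,
      mul_comm s n]
    omega
  have hset : (((Finset.range L).image fun t : ℕ => c + (d : ℤ) * t).filter
      fun h => h % (n : ℤ) = a) = (Finset.range L').image
        fun s : ℕ => (c + d * t₀) + ((d * n : ℕ) : ℤ) * s := by
    ext h
    simp only [Finset.mem_filter, Finset.mem_image, Finset.mem_range]
    constructor
    · rintro ⟨⟨t, ht, rfl⟩, h2⟩
      obtain ⟨z, hz⟩ := (hmem t).1 h2
      have hz0 : 0 ≤ z := by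
        by_contra hneg
        have h3 : (n : ℤ) * z ≤ n * (-1) := by gcongr; omega
        have : (0 : ℤ) ≤ t := by positivity
        have : (t₀ : ℤ) < n := by exact_mod_cast ht₀n
        omega
      lift z to ℕ using hz0
      refine ⟨z, (hlt z).2 ?_, ?_⟩
      · have : (t : ℤ) = t₀ + n * z := by linarith
        have : t = t₀ + n * z := by exact_mod_cast this
        omega
      · push_cast
        linear_combination -(d : ℤ) * hz
    · rintro ⟨s, hs, rfl⟩
      have h3 : (c + d * t₀) + ((d * n : ℕ) : ℤ) * s = c + d * ((t₀ + n * s : ℕ) : ℤ) := by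
        push_cast; ring
      rw [h3]
      refine ⟨⟨_, (hlt s).1 hs, rfl⟩, (hmem _).2 ?_⟩
      push_cast
      simp
  rw [hset, card_progression (mul_ne_zero hd hn), card_progression hd]
  have hnR : (0 : ℝ) < n := by positivity
  have h4 : L' * n ≤ L + (n - 1 - t₀) := by rw [hL']; exact Nat.div_mul_le_self _ _
  have h5 : L + (n - 1 - t₀) < (L' + 1) * n := by
    have := Nat.lt_mul_div_succ (L + (n - 1 - t₀)) (Nat.pos_of_ne_zero hn)
    rw [← hL'] at this
    rw [mul_comm]; exact this
  have h6 : (L' : ℝ) * n < L + n := by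
    have : L' * n < L + n := by omega
    exact_mod_cast this
  have h7 : (L : ℝ) < (L' + 1) * n := by
    have : L < (L' + 1) * n := by omega
    exact_mod_cast this
  have h8 : (L' : ℝ) < L / n + 1 := by
    rw [← sub_lt_iff_lt_add, lt_div_iff₀ hnR]; linarith
  have h9 : (L : ℝ) / n < L' + 1 := by rwa [div_lt_iff₀ hnR]
  refine ⟨⟨_, _, rfl⟩, ?_, h8⟩
  rw [abs_le]; constructor <;> linarith

/-! ### Moment bounds for sifted progressions. -/

/-- Strong induction on the length handles the classes, whose difference d n stays coprime to the
remaining moduli; an inner induction on the list accumulates the increments of V, and the smallness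
hypothesis caps their total at L^θ. -/
theorem siftedMoment_le_of_sum_rpow_le (r : ℕ) {θ : ℝ} (hθ : 0 < θ) (hθ' : θ ≤ 1) (L : ℕ) :
    ∀ (d : ℕ) (l : List ℕ), d ≠ 0 → (∀ n ∈ l, 2 ≤ n) → l.Pairwise Nat.Coprime →
      (∀ n ∈ l, d.Coprime n) →
      324 * 4 ^ (r + 1) * (l.map fun n : ℕ => (n : ℝ) ^ (-θ)).sum ≤ 1 →
      ∀ T : Finset ℤ, IsProgression d T → T.card = L →
        siftedMoment r l T ≤ (2 * (L : ℝ) ^ θ) ^ (r + 1) := by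
  induction L using Nat.strong_induction_on with
  | _ L ihL =>
  intro d l hd hl2 hlc hdl hsum T hT hTL
  rcases Nat.eq_zero_or_pos L with rfl | hLpos
  · rw [Finset.card_eq_zero.1 hTL, siftedMoment_empty fun n hn => by have := hl2 n hn; omega]
    positivity
  have hL1 : (1 : ℝ) ≤ L := by exact_mod_cast hLpos
  have hLθ : 1 ≤ (L : ℝ) ^ θ := Real.one_le_rpow hL1 hθ.le
  have hsum0 : ∀ l : List ℕ, 0 ≤ (l.map fun n : ℕ => (n : ℝ) ^ (-θ)).sum := by
    intro l
    refine List.sum_nonneg ?_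
    simp only [List.mem_map, forall_exists_index, and_imp]
    rintro _ n _ rfl
    positivity
  have main : siftedMoment r l T ≤ ((L : ℝ) ^ θ *
      (1 + 324 * 4 ^ (r + 1) * (l.map fun n : ℕ => (n : ℝ) ^ (-θ)).sum)) ^ (r + 1) := by
    induction l with
    | nil =>
      simp only [siftedMoment, sieveMean, sieveDensity, List.map_nil, List.prod_nil, one_mul,
        sub_self, List.sum_nil, mul_zero, add_zero, mul_one]
      rw [zero_pow (by omega)]
      positivity
    | cons n l ih =>
      have hl2' : ∀ m ∈ l, 2 ≤ m := fun m hm => hl2 m (by simp [hm])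
      have hl0 : ∀ m ∈ l, m ≠ 0 := fun m hm => by have := hl2' m hm; omega
      have hn2 : 2 ≤ n := hl2 n (by simp)
      have hn0 : n ≠ 0 := by omega
      have hnR : (0 : ℝ) < n := by positivity
      have hdn : d.Coprime n := hdl n (by simp)
      rw [List.pairwise_cons] at hlc
      rw [List.map_cons, List.sum_cons] at hsum ⊢
      have hnθ : 0 ≤ (n : ℝ) ^ (-θ) := by positivity
      have hsl := hsum0 l
      have h4 : (1 : ℝ) ≤ 4 ^ (r + 1) := one_le_pow₀ (by norm_num)
      have hsum' : 324 * 4 ^ (r + 1) * (l.map fun n : ℕ => (n : ℝ) ^ (-θ)).sum ≤ 1 := by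
        refine le_trans ?_ hsum
        gcongr
        linarith
      have hdl' : ∀ m ∈ l, d.Coprime m := fun m hm => hdl m (by simp [hm])
      specialize ih hl2' hlc.2 hdl' hsum'
      have hnsmall : 324 * (n : ℝ) ^ (-θ) ≤ 1 := by
        refine le_trans ?_ hsum
        rw [mul_assoc]
        gcongr
        nlinarith
      set V := (L : ℝ) ^ θ *
        (1 + 324 * 4 ^ (r + 1) * (l.map fun n : ℕ => (n : ℝ) ^ (-θ)).sum) with hV
      have hVL : (L : ℝ) ^ θ ≤ V := by
        refine le_mul_of_one_le_right (by positivity) ?_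
        have : 0 ≤ 324 * 4 ^ (r + 1) * (l.map fun n : ℕ => (n : ℝ) ^ (-θ)).sum := by positivity
        linarith
      -- 108 = 9 · 3 · 4: 9 from `excessMoment_le`, 3 from 2B + 1 ≤ 3B, and 4 from the inductive
      -- bound for lengths below 2L/n. Then 324 = 3 · 108.
      set s := 108 * ((L : ℝ) / n) ^ θ with hs
      have hLn : ((L : ℝ) / n) ^ θ = (L : ℝ) ^ θ * (n : ℝ) ^ (-θ) := by
        rw [Real.div_rpow (by positivity) (by positivity), Real.rpow_neg (by positivity),
          div_eq_mul_inv]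
      have hgoal : (L : ℝ) ^ θ * (1 + 324 * 4 ^ (r + 1) * ((n : ℝ) ^ (-θ) +
          (l.map fun n : ℕ => (n : ℝ) ^ (-θ)).sum)) = V + 3 * 4 ^ (r + 1) * s := by
        rw [hV, hs, hLn]; ring
      rw [hgoal]
      have hfilter := fun a ha => hT.filter hd hn0 hdn (a := a) ha
      rw [hTL] at hfilter
      rcases lt_or_ge L n with hlt | hge
      · have hlt' : (L : ℝ) / n < 1 := by
          rw [div_lt_one hnR]; exact_mod_cast hlt
        refine siftedMoment_cons_le_of_card_le_one hn0 hl0 (fun a ha => ?_) (by omega)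
          (hLθ.trans hVL) ?_ ih
        · have h5 := (hfilter a ha).2.2
          have h6 : ((T.filter fun h => h % (n : ℤ) = a).card : ℝ) < (2 : ℕ) := by
            push_cast; linarith
          have := Nat.cast_lt.1 h6
          omega
        · rw [hTL, hs]
          have h5 : (L : ℝ) / n ≤ ((L : ℝ) / n) ^ θ :=
            Real.self_le_rpow_of_le_one (by positivity) hlt'.le hθ'
          have h6 : 0 ≤ ((L : ℝ) / n) ^ θ := by positivity
          linarith
      · have hge' : 1 ≤ (L : ℝ) / n := by
          rw [one_le_div hnR]; exact_mod_cast hge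
        have h1θ : 1 ≤ ((L : ℝ) / n) ^ θ := Real.one_le_rpow hge' hθ.le
        refine siftedMoment_cons_le_of_excessMoment hn0 (by positivity) ?_ ih ?_
        · refine le_trans ?_ hVL
          rw [hs, hLn]
          nlinarith
        · set B := (4 * ((L : ℝ) / n) ^ θ) ^ (r + 1) with hB
          have hB1 : 1 ≤ B := one_le_pow₀ (by linarith)
          have h5 : excessMoment r n l T ≤ 9 ^ (r + 1) * (2 * B + 1) := by
            refine excessMoment_le hn0 hl0 (fun a ha => ?_) fun a ha => ?_
            · rw [hTL]; exact (hfilter a ha).2.1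
            · obtain ⟨hp, -, hcard⟩ := hfilter a ha
              -- The outer induction applies because L/n + 1 ≤ L/2 + 1 ≤ L.
              have h6 : (T.filter fun h => h % (n : ℤ) = a).card < L := by
                have h7 : (L : ℝ) / n ≤ L / 2 := by
                  gcongr; exact_mod_cast hn2
                have h8 : (2 : ℝ) ≤ L := by exact_mod_cast hn2.trans hge
                have h9 : ((T.filter fun h => h % (n : ℤ) = a).card : ℝ) < L := by linarith
                exact_mod_cast h9
              refine (ihL _ h6 (d * n) l (mul_ne_zero hd hn0) hl2' hlc.2 (fun m hm =>
                Nat.Coprime.mul_left (hdl' m hm) (hlc.1 m hm)) hsum' _ hp rfl).trans ?_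
              rw [hB]
              gcongr ?_ ^ _
              calc 2 * ((T.filter fun h => h % (n : ℤ) = a).card : ℝ) ^ θ
                  ≤ 2 * (2 * ((L : ℝ) / n)) ^ θ := by
                    gcongr; linarith
                _ = 2 * (2 ^ θ * ((L : ℝ) / n) ^ θ) := by
                    rw [Real.mul_rpow (by norm_num) (by positivity)]
                _ ≤ 2 * (2 ^ (1 : ℝ) * ((L : ℝ) / n) ^ θ) := by
                    gcongr; norm_num
                _ = _ := by rw [Real.rpow_one]; ring
          refine h5.trans ?_
          calc (9 : ℝ) ^ (r + 1) * (2 * B + 1) ≤ 9 ^ (r + 1) * (3 ^ (r + 1) * B) := by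
                gcongr
                have : (3 : ℝ) ^ 1 ≤ 3 ^ (r + 1) := pow_le_pow_right₀ (by norm_num) (by omega)
                nlinarith
            _ = s ^ (r + 1) := by
                rw [hB, hs, ← mul_pow, ← mul_pow]; congr 1; ring
  have := hsum0 l
  refine main.trans (pow_le_pow_left₀ (by positivity) ?_ _)
  nlinarith

/-- The moduli of `l₁` need not be small in sum. Here `L` only bounds the length from above, so the
same `L` serves for every class. -/
theorem siftedMoment_append_le (r : ℕ) {θ : ℝ} (hθ : 0 < θ) (hθ' : θ ≤ 1) (l₂ : List ℕ)
    (hsum : 324 * 4 ^ (r + 1) * (l₂.map fun n : ℕ => (n : ℝ) ^ (-θ)).sum ≤ 1) (l₁ : List ℕ) :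
    ∀ d : ℕ, d ≠ 0 → (∀ n ∈ l₁ ++ l₂, 2 ≤ n) → (l₁ ++ l₂).Pairwise Nat.Coprime →
      (∀ n ∈ l₁ ++ l₂, d.Coprime n) → ∀ T : Finset ℤ, IsProgression d T → ∀ L : ℕ, 1 ≤ L →
      T.card ≤ L → siftedMoment r (l₁ ++ l₂) T ≤
        (4 ^ (r + 1) * (1 + 3 * 9 ^ (r + 1))) ^ l₁.length * (2 * (L : ℝ) ^ θ) ^ (r + 1) := by
  induction l₁ with
  | nil =>
    intro d hd hl2 hlc hdl T hT L hL hTL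
    simp only [List.nil_append, List.length_nil, pow_zero, one_mul] at *
    refine (siftedMoment_le_of_sum_rpow_le r hθ hθ' _ d l₂ hd hl2 hlc hdl hsum T hT rfl).trans ?_
    gcongr
  | cons n l ih =>
    intro d hd hl2 hlc hdl T hT L hL hTL
    rw [List.cons_append] at *
    rw [List.pairwise_cons] at hlc
    have hl2' : ∀ m ∈ l ++ l₂, 2 ≤ m := fun m hm => hl2 m (List.mem_cons_of_mem _ hm)
    have hl0 : ∀ m ∈ l ++ l₂, m ≠ 0 := fun m hm => by have := hl2' m hm; omega
    have hn0 : n ≠ 0 := by have := hl2 n (by simp); omega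
    have hdl' : ∀ m ∈ l ++ l₂, d.Coprime m := fun m hm => hdl m (List.mem_cons_of_mem _ hm)
    set C : ℝ := 4 ^ (r + 1) * (1 + 3 * 9 ^ (r + 1)) with hC
    have hC1 : 1 ≤ C := by
      have h4 : (1 : ℝ) ≤ 4 ^ (r + 1) := one_le_pow₀ (by norm_num)
      have h9 : (1 : ℝ) ≤ 9 ^ (r + 1) := one_le_pow₀ (by norm_num)
      nlinarith
    set B := C ^ l.length * (2 * (L : ℝ) ^ θ) ^ (r + 1) with hB
    have hB1 : 1 ≤ B := by
      refine one_le_mul_of_one_le_of_one_le (one_le_pow₀ hC1) (one_le_pow₀ ?_)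
      have := Real.one_le_rpow (show (1 : ℝ) ≤ L by exact_mod_cast hL) hθ.le
      linarith
    have h1 := ih d hd hl2' hlc.2 hdl' T hT L hL hTL
    have h2 : excessMoment r n (l ++ l₂) T ≤ 9 ^ (r + 1) * (2 * B + 1) := by
      refine excessMoment_le hn0 hl0
        (fun a ha => (hT.filter hd hn0 (hdl n (by simp)) ha).2.1) fun a ha => ?_
      exact ih (d * n) (mul_ne_zero hd hn0) hl2' hlc.2
        (fun m hm => Nat.Coprime.mul_left (hdl' m hm) (hlc.1 m hm)) _
        (hT.filter hd hn0 (hdl n (by simp)) ha).1 L hL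
        ((Finset.card_le_card (Finset.filter_subset _ _)).trans hTL)
    refine (siftedMoment_cons_le_crude hn0 T).trans ?_
    calc _ ≤ 4 ^ (r + 1) * (B + 9 ^ (r + 1) * (2 * B + B)) := by
          gcongr; exact h2.trans (by gcongr)
      _ = _ := by rw [hB, hC, List.length_cons, pow_succ]; ring

/-! ### Sieve moments as truncated singular series, and convergence of the products. -/

theorem card_pow_eq_sum (j : ℕ) {T T' : Finset ℤ} (hT' : T' ⊆ T) :
    (T'.card : ℝ) ^ j = ∑ h ∈ Fintype.piFinset (fun _ : Fin j => T),
      if Finset.univ.image h ⊆ T' then (1 : ℝ) else 0 := by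
  rw [← Finset.sum_filter, Finset.sum_const, nsmul_eq_mul, mul_one]
  have : (Fintype.piFinset (fun _ : Fin j => T)).filter (fun h => Finset.univ.image h ⊆ T') =
      Fintype.piFinset (fun _ : Fin j => T') := by
    ext h
    simp only [Finset.mem_filter, Fintype.mem_piFinset, Finset.image_subset_iff, Finset.mem_univ,
      true_implies]
    exact ⟨fun h => h.2, fun h => ⟨fun i => hT' (h i), h⟩⟩
  rw [this, Fintype.card_piFinset_const]
  push_cast
  rfl

theorem card_image_emod (k p : ℕ) {j : ℕ} (h : Fin j → ℤ) :
    ((Finset.univ.image h).image fun a => a % ((p ^ k : ℕ) : ℤ)).card = residueCount k h p := by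
  rw [residueCount, Finset.image_image]
  have : (Finset.univ.image fun i => (h i : ZMod (p ^ k))) =
      (Finset.univ.image ((fun a => a % ((p ^ k : ℕ) : ℤ)) ∘ h)).image
        (fun a : ℤ => (a : ZMod (p ^ k))) := by
    rw [Finset.image_image]
    refine Finset.image_congr fun i _ => ?_
    simp only [Function.comp_apply]
    rw [ZMod.intCast_eq_intCast_iff']
    simp
  rw [this]
  refine (Finset.card_image_of_injOn ?_).symm
  intro a ha b hb hab
  simp only [Finset.coe_image, Finset.coe_univ, Set.image_univ, Set.mem_range,
    Function.comp_apply] at ha hb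
  obtain ⟨i, rfl⟩ := ha
  obtain ⟨i', rfl⟩ := hb
  simpa [ZMod.intCast_eq_intCast_iff'] using hab

theorem residueCount_le (k p : ℕ) {j : ℕ} (h : Fin j → ℤ) : residueCount k h p ≤ j := by
  simpa [residueCount] using
    Finset.card_image_le (s := Finset.univ) (f := fun i => (h i : ZMod (p ^ k)))

/-- The central moments of the sifted set, expanded in truncated singular series. -/
theorem sieveMean_sub_pow {l : List ℕ} (hl : ∀ n ∈ l, n ≠ 0) (x : ℝ) (ℓ : ℕ) (T : Finset ℤ) :
    sieveMean l (fun T' => ((T'.card : ℝ) - x) ^ ℓ) T =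
      ∑ j ∈ Finset.range (ℓ + 1), (ℓ.choose j : ℝ) * (-x) ^ (ℓ - j) *
        ∑ h ∈ Fintype.piFinset (fun _ : Fin j => T), (l.map fun n : ℕ =>
          1 - (((Finset.univ.image h).image fun a => a % (n : ℤ)).card : ℝ) / n).prod := by
  have h1 : ∀ T' ⊆ T, ((T'.card : ℝ) - x) ^ ℓ = ∑ j ∈ Finset.range (ℓ + 1),
      ((ℓ.choose j : ℝ) * (-x) ^ (ℓ - j)) * ∑ h ∈ Fintype.piFinset (fun _ : Fin j => T),
        if Finset.univ.image h ⊆ T' then (1 : ℝ) else 0 := by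
    intro T' hT'
    rw [sub_eq_add_neg, add_pow]
    refine Finset.sum_congr rfl fun j _ => ?_
    rw [← card_pow_eq_sum j hT']
    ring
  rw [sieveMean_congr h1, sieveMean_sum]
  refine Finset.sum_congr rfl fun j _ => ?_
  rw [sieveMean_const_mul, sieveMean_sum]
  congr 1
  refine Finset.sum_congr rfl fun h hh => ?_
  refine sieveMean_indicator hl _ T ?_
  rw [Finset.image_subset_iff]
  exact fun i _ => Fintype.mem_piFinset.1 hh i

theorem summable_residueCount_div {k : ℕ} (hk : 2 ≤ k) (q : ℕ) {j : ℕ} (h : Fin j → ℤ) :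
    Summable fun p : {p : ℕ // p.Prime ∧ ¬ p ∣ q} =>
      (residueCount k h p : ℝ) / ((p : ℕ) : ℝ) ^ k := by
  have h1 : Summable fun p : {p : ℕ // p.Prime ∧ ¬ p ∣ q} =>
      (j : ℝ) * (1 / ((p : ℕ) : ℝ) ^ k) :=
    ((Real.summable_one_div_nat_pow.2 hk).comp_injective Subtype.val_injective).mul_left _
  refine Summable.of_nonneg_of_le (fun p => by positivity) (fun p => ?_) h1
  rw [mul_one_div]
  gcongr
  exact residueCount_le _ _ _

theorem hasProd_singularSeries {k : ℕ} (hk : 2 ≤ k) (q : ℕ) {j : ℕ} (h : Fin j → ℤ) :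
    HasProd (fun p : {p : ℕ // p.Prime ∧ ¬ p ∣ q} =>
      1 - (residueCount k h p : ℝ) / ((p : ℕ) : ℝ) ^ k) (singularSeries k q h) := by
  have h1 := multipliable_one_add_of_summable (f := fun p : {p : ℕ // p.Prime ∧ ¬ p ∣ q} =>
    -((residueCount k h p : ℝ) / ((p : ℕ) : ℝ) ^ k))
    (by simpa using (summable_residueCount_div hk q h).norm)
  simp only [← sub_eq_add_neg] at h1
  exact h1.hasProd

theorem hasProd_kfreeDensity {k : ℕ} (hk : 2 ≤ k) (q : ℕ) :
    HasProd (fun p : {p : ℕ // p.Prime ∧ ¬ p ∣ q} => 1 - 1 / ((p : ℕ) : ℝ) ^ k)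
      (kfreeDensity k q) := by
  have h1 := multipliable_one_add_of_summable (f := fun p : {p : ℕ // p.Prime ∧ ¬ p ∣ q} =>
    -(1 / ((p : ℕ) : ℝ) ^ k))
    (by simpa using ((Real.summable_one_div_nat_pow.2 hk).comp_injective
      Subtype.val_injective).norm)
  simp only [← sub_eq_add_neg] at h1
  exact h1.hasProd

theorem isProgression_Ico (N : ℤ) : IsProgression 1 (Finset.Ico 0 N) := by
  refine ⟨0, N.toNat, ?_⟩
  ext a
  simp only [Finset.mem_Ico, Finset.mem_image, Finset.mem_range]
  constructor
  · rintro ⟨h1, h2⟩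
    exact ⟨a.toNat, by omega, by simp [h1]⟩
  · rintro ⟨t, ht, rfl⟩
    push_cast
    omega

/-- Uniformity in q and s: the exceptional set `s₀` comes from the tail of ∑ n^(-kθ) over all n, so
it depends on neither. Primes in `s₀` go to the front of the list, the rest behind. -/
theorem exists_siftedMoment_le (r : ℕ) {k : ℕ} (hk : 2 ≤ k) {θ : ℝ} (hθ : 0 < θ) (hθ' : θ ≤ 1)
    (hkθ : 1 < k * θ) : ∃ K : ℝ, 0 < K ∧ ∀ (q : ℕ) (s : Finset {p : ℕ // p.Prime ∧ ¬ p ∣ q}),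
      ∃ l : List ℕ, (∀ n ∈ l, n ≠ 0) ∧
        (∀ g : ℕ → ℝ, (l.map g).prod = ∏ p ∈ s, g ((p : ℕ) ^ k)) ∧
        ∀ (N : ℤ) (L : ℕ), 1 ≤ L → N ≤ L →
          siftedMoment r l (Finset.Ico 0 N) ≤ K * ((L : ℝ) ^ θ) ^ (r + 1) := by
  classical
  have hsum : Summable fun n : ℕ => (n : ℝ) ^ (-(k * θ)) :=
    Real.summable_nat_rpow.2 (by linarith)
  obtain ⟨s₀, hs₀⟩ := summable_iff_vanishing_norm.1 hsum (1 / (324 * 4 ^ (r + 1))) (by positivity)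
  set C : ℝ := 4 ^ (r + 1) * (1 + 3 * 9 ^ (r + 1)) with hC
  have hC1 : 1 ≤ C := by
    have h4 : (1 : ℝ) ≤ 4 ^ (r + 1) := one_le_pow₀ (by norm_num)
    have h9 : (1 : ℝ) ≤ 9 ^ (r + 1) := one_le_pow₀ (by norm_num)
    nlinarith
  refine ⟨C ^ s₀.card * 2 ^ (r + 1), by positivity, fun q s => ?_⟩
  set f : {p : ℕ // p.Prime ∧ ¬ p ∣ q} → ℕ := fun p => (p : ℕ) ^ k with hf
  set s₁ := s.filter fun p : {p : ℕ // p.Prime ∧ ¬ p ∣ q} => (p : ℕ) ∈ s₀ with hs₁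
  set s₂ := s.filter fun p : {p : ℕ // p.Prime ∧ ¬ p ∣ q} => ¬ (p : ℕ) ∈ s₀ with hs₂
  have hperm : (s₁.toList ++ s₂.toList).Perm s.toList := by
    have hd : Disjoint s₁ s₂ := Finset.disjoint_filter_filter_not _ _ _
    have hu : s₁.disjUnion s₂ hd = s := by
      rw [Finset.disjUnion_eq_union]; exact Finset.filter_union_filter_not_eq _ _
    rw [← Multiset.coe_eq_coe, ← Multiset.coe_add]
    simp only [Finset.coe_toList]
    rw [← hu]; rfl
  have hprime : ∀ p : {p : ℕ // p.Prime ∧ ¬ p ∣ q}, 2 ≤ f p := fun p =>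
    p.2.1.two_le.trans (Nat.le_self_pow (by omega) _)
  have hl2 : ∀ n ∈ s₁.toList.map f ++ s₂.toList.map f, 2 ≤ n := by
    rw [← List.map_append]
    intro n hn
    obtain ⟨p, -, rfl⟩ := List.mem_map.1 hn
    exact hprime p
  refine ⟨s₁.toList.map f ++ s₂.toList.map f, fun n hn => by have := hl2 n hn; omega,
    fun g => ?_, fun N L hL hNL => ?_⟩
  · rw [← List.map_append, List.map_map, (hperm.map _).prod_eq, Finset.prod_map_toList]
    rfl
  · have h1 := siftedMoment_append_le r hθ hθ' (s₂.toList.map f) ?_ (s₁.toList.map f) 1 one_ne_zero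
      hl2 ?_ (fun n _ => Nat.coprime_one_left n) (Finset.Ico 0 N) (isProgression_Ico N) L hL
      (by simp only [Int.card_Ico]; omega)
    · refine h1.trans ?_
      rw [← hC, mul_pow 2, ← mul_assoc]
      gcongr
      rw [List.length_map, Finset.length_toList]
      refine Finset.card_le_card_of_injOn (fun p => (p : ℕ)) (fun p hp => ?_)
        Subtype.val_injective.injOn
      exact (Finset.mem_filter.1 hp).2
    · rw [List.map_map, Finset.sum_map_toList]
      have h2 := hs₀ (s₂.map ⟨Subtype.val, Subtype.val_injective⟩) (by
        rw [Finset.disjoint_left]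
        intro n hn
        obtain ⟨p, hp, rfl⟩ := Finset.mem_map.1 hn
        exact (Finset.mem_filter.1 hp).2)
      rw [Finset.sum_map] at h2
      have h3 : ∑ p ∈ s₂, ((fun n : ℕ => (n : ℝ) ^ (-θ)) ∘ f) p =
          ∑ p ∈ s₂, (((p : ℕ) : ℝ)) ^ (-(k * θ)) := by
        refine Finset.sum_congr rfl fun p _ => ?_
        simp only [Function.comp_apply, hf]
        push_cast
        rw [← Real.rpow_natCast, ← Real.rpow_mul (by positivity)]
        congr 1; ring
      rw [h3]
      have h4 := (le_abs_self _).trans (Real.norm_eq_abs _ ▸ h2.le)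
      simp only [Function.Embedding.coeFn_mk] at h4
      rw [le_div_iff₀ (by positivity)] at h4
      linarith
    · rw [← List.map_append, List.pairwise_map]
      have hnd : (s₁.toList ++ s₂.toList).Nodup := hperm.nodup_iff.2 s.nodup_toList
      refine hnd.imp fun {p p'} hne => ?_
      exact Nat.coprime_pow_primes _ _ p.2.1 p'.2.1 fun h => hne (Subtype.ext h)

/-! ### Reduction to a fixed u, and the theorem. -/

theorem singularMoment_eq_integral (k : ℕ) {ℓ : ℕ} (q : ℕ) (H : ℝ) :
    singularMoment k ℓ q H = ∫ u in (H - 1)..H, ∑ j ∈ Finset.range (ℓ + 1),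
      (ℓ.choose j : ℝ) * (-(kfreeDensity k q * H)) ^ (ℓ - j) *
        ∑ h ∈ Fintype.piFinset (fun _ : Fin j => Finset.Ico (0 : ℤ) ⌈u⌉),
          singularSeries k q h := by
  have hint : ∀ g : ℤ → ℝ, IntervalIntegrable (fun u : ℝ => g ⌈u⌉) MeasureTheory.volume
      (H - 1) H := by
    intro g
    have hm : Measurable fun u : ℝ => g ⌈u⌉ := (measurable_from_top (f := g)).comp Int.measurable_ceil
    rw [intervalIntegrable_iff]
    refine MeasureTheory.Measure.integrableOn_of_bounded
      (M := ∑ N ∈ Finset.Icc ⌈H - 1⌉ ⌈H⌉, |g N|) (by simp) hm.aestronglyMeasurable ?_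
    refine MeasureTheory.ae_restrict_of_forall_mem measurableSet_uIoc fun u hu => ?_
    rw [Set.uIoc_of_le (by linarith)] at hu
    exact Finset.single_le_sum (f := fun N => |g N|) (fun _ _ => abs_nonneg _)
      (Finset.mem_Icc.2 ⟨Int.ceil_mono hu.1.le, Int.ceil_mono hu.2⟩)
  rw [singularMoment, intervalIntegral.integral_finsetSum fun j _ =>
    hint fun N => (ℓ.choose j : ℝ) * (-(kfreeDensity k q * H)) ^ (ℓ - j) *
        ∑ h ∈ Fintype.piFinset (fun _ : Fin j => Finset.Ico (0 : ℤ) N), singularSeries k q h]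
  refine Finset.sum_congr rfl fun j _ => ?_
  rw [intervalIntegral.integral_const_mul, singularSum]
  -- For j = 0 the only tuple is empty with series 1, and the interval has length 1.
  split_ifs with hj
  · subst hj
    simp [singularSeries, residueCount]
  · rfl

theorem theorem3 (ε : ℝ) (hε : 0 < ε) (k ℓ : ℕ) (hk : 2 ≤ k) (hℓ : 2 ≤ ℓ) :
    ∃ K : ℝ, 0 < K ∧ ∀ q : ℕ, 1 ≤ q → ∀ H : ℝ, 1 ≤ H →
      |singularMoment k ℓ q H| ≤ K * H ^ ((ℓ : ℝ) / (2 * (k : ℝ)) + ε) := by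
  obtain ⟨r, rfl⟩ : ∃ r, ℓ = r + 1 := ⟨ℓ - 1, by omega⟩
  set ℓ := r + 1 with hℓr
  have hkR : (2 : ℝ) ≤ k := by exact_mod_cast hk
  have hℓR : (2 : ℝ) ≤ ℓ := by exact_mod_cast hℓ
  -- Chosen so that θℓ is at most twice the target exponent, while kθ > 1 survives the cap at 1
  -- because k ≥ 2.
  set θ : ℝ := min (1 / k + 2 * ε / ℓ) 1 with hθdef
  have hθ : 0 < θ := lt_min (by positivity) one_pos
  have hθ' : θ ≤ 1 := min_le_right _ _
  have hkθ : 1 < k * θ := by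
    rw [hθdef, mul_min_of_nonneg _ _ (by positivity), lt_min_iff]
    constructor
    · have : (k : ℝ) * (1 / k + 2 * ε / ℓ) = 1 + k * (2 * ε / ℓ) := by field_simp
      rw [this]
      have : 0 < (k : ℝ) * (2 * ε / ℓ) := by positivity
      linarith
    · linarith
  obtain ⟨K, hK, hmoment⟩ := exists_siftedMoment_le r hk hθ hθ' hkθ
  refine ⟨1 + 4 ^ (r + 1) * (K * 2 ^ (r + 1) + 1), by positivity, fun q _ H hH => ?_⟩
  set Λ : ℝ := H ^ ((ℓ : ℝ) / (2 * (k : ℝ)) + ε) with hΛ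
  have hΛ1 : 1 ≤ Λ := Real.one_le_rpow hH (by positivity)
  have hΛ0 : 0 < Λ := by linarith
  have hHΛ : (H ^ θ) ^ (r + 1) ≤ Λ ^ 2 := by
    rw [hΛ, ← Real.rpow_natCast, ← Real.rpow_natCast, ← Real.rpow_mul (by positivity),
      ← Real.rpow_mul (by positivity)]
    refine Real.rpow_le_rpow_of_exponent_le hH ?_
    calc θ * (ℓ : ℝ) ≤ (1 / k + 2 * ε / ℓ) * ℓ := by gcongr; exact min_le_left _ _
      _ = _ := by push_cast; field_simp
  have hpoint : ∀ N : ℤ, |(N : ℝ) - H| ≤ 1 → |∑ j ∈ Finset.range (ℓ + 1),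
      (ℓ.choose j : ℝ) * (-(kfreeDensity k q * H)) ^ (ℓ - j) *
        ∑ h ∈ Fintype.piFinset (fun _ : Fin j => Finset.Ico (0 : ℤ) N), singularSeries k q h| ≤
      (1 + 4 ^ (r + 1) * (K * 2 ^ (r + 1) + 1)) * Λ := by
    intro N hN
    have hN' := abs_le.1 hN
    have hN0 : 0 ≤ N := by
      have : (0 : ℝ) ≤ N := by linarith
      exact_mod_cast this
    have hlim : Filter.Tendsto (fun s : Finset {p : ℕ // p.Prime ∧ ¬ p ∣ q} =>
        |∑ j ∈ Finset.range (ℓ + 1), (ℓ.choose j : ℝ) *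
          (-((∏ p ∈ s, (1 - 1 / ((p : ℕ) : ℝ) ^ k)) * H)) ^ (ℓ - j) *
          ∑ h ∈ Fintype.piFinset (fun _ : Fin j => Finset.Ico (0 : ℤ) N),
            ∏ p ∈ s, (1 - (residueCount k h p : ℝ) / ((p : ℕ) : ℝ) ^ k)|) Filter.atTop
        (nhds |∑ j ∈ Finset.range (ℓ + 1),
          (ℓ.choose j : ℝ) * (-(kfreeDensity k q * H)) ^ (ℓ - j) *
          ∑ h ∈ Fintype.piFinset (fun _ : Fin j => Finset.Ico (0 : ℤ) N),
            singularSeries k q h|) := by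
      refine (tendsto_finsetSum _ fun j _ => ?_).abs
      refine Filter.Tendsto.mul (Filter.Tendsto.mul tendsto_const_nhds
        (Filter.Tendsto.pow (Filter.Tendsto.neg (Filter.Tendsto.mul_const _ ?_)) _)) ?_
      · exact hasProd_kfreeDensity hk q
      · exact tendsto_finsetSum _ fun h _ => hasProd_singularSeries hk q h
    -- The bound is uniform in the truncation `s`, so it passes to the infinite products.
    refine le_of_tendsto' hlim fun s => ?_
    obtain ⟨l, hl0, hlprod, hlmoment⟩ := hmoment q s
    have hdens : sieveDensity l = ∏ p ∈ s, (1 - 1 / ((p : ℕ) : ℝ) ^ k) := by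
      rw [sieveDensity, hlprod]; push_cast; rfl
    have hexp := sieveMean_sub_pow hl0 (sieveDensity l * H) ℓ (Finset.Ico 0 N)
    simp only [hlprod, card_image_emod] at hexp
    simp only [Nat.cast_pow] at hexp
    rw [← hdens, ← hexp]
    have hcard : ((Finset.Ico 0 N).card : ℝ) = N := by
      rw [Int.card_Ico, sub_zero]
      exact_mod_cast Int.toNat_of_nonneg hN0
    have hy : ∀ T' : Finset ℤ, |((T'.card : ℝ) - sieveDensity l * H) ^ ℓ| ≤
        (Λ + 4 ^ (r + 1) / Λ) + 4 ^ (r + 1) / Λ *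
          ((T'.card : ℝ) - sieveDensity l * (Finset.Ico 0 N).card) ^ (2 * r + 2) := by
      intro T'
      rw [hcard]
      set w := (T'.card : ℝ) - sieveDensity l * N
      have hyw : (T'.card : ℝ) - sieveDensity l * H = w + sieveDensity l * (N - H) := by
        simp only [w]; ring
      set y := (T'.card : ℝ) - sieveDensity l * H
      -- Since 2r + 2 = 2ℓ, the even moment, of size Λ^2, controls the ℓ-th one even for odd ℓ.
      have h1 : |y ^ ℓ| ≤ Λ + y ^ (2 * r + 2) / Λ := by
        have h2 : y ^ (2 * r + 2) = |y ^ ℓ| ^ 2 := by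
          rw [sq_abs, ← pow_mul, hℓr]; congr 1; ring
        rw [h2]
        rcases le_total |y ^ ℓ| Λ with h | h
        · have : 0 ≤ |y ^ ℓ| ^ 2 / Λ := by positivity
          linarith
        · have : |y ^ ℓ| ≤ |y ^ ℓ| ^ 2 / Λ := by
            rw [le_div_iff₀ hΛ0, sq]; gcongr
          linarith
      have h3 : y ^ (2 * r + 2) ≤ 4 ^ (r + 1) * (w ^ (2 * r + 2) + 1) := by
        rw [hyw]
        refine (even_pow_add_le r _ _).trans ?_
        gcongr
        rw [← (even_two_mul_add_two r).pow_abs]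
        refine pow_le_one₀ (abs_nonneg _) ?_
        rw [abs_mul, abs_of_nonneg (sieveDensity_mem l).1]
        exact mul_le_one₀ (sieveDensity_mem l).2 (abs_nonneg _) hN
      calc |y ^ ℓ| ≤ Λ + 4 ^ (r + 1) * (w ^ (2 * r + 2) + 1) / Λ := h1.trans (by gcongr)
        _ = _ := by ring
    have hbound : sieveMean l (fun T' => (Λ + 4 ^ (r + 1) / Λ) + 4 ^ (r + 1) / Λ *
          ((T'.card : ℝ) - sieveDensity l * (Finset.Ico 0 N).card) ^ (2 * r + 2))
        (Finset.Ico 0 N) ≤ (1 + 4 ^ (r + 1) * (K * 2 ^ (r + 1) + 1)) * Λ := by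
      rw [sieveMean_add, sieveMean_const hl0, sieveMean_const_mul]
      have h1 : siftedMoment r l (Finset.Ico 0 N) ≤ K * (2 ^ (r + 1) * Λ ^ 2) := by
        -- The maximum covers N = 0, since the length bound must be at least 1.
        refine (hlmoment N (max N.toNat 1) (le_max_right _ _) (by omega)).trans ?_
        gcongr
        have h2 : ((max N.toNat 1 : ℕ) : ℝ) ≤ 2 * H := by
          rw [Nat.cast_max, Nat.cast_one, max_le_iff]
          refine ⟨?_, by linarith⟩
          have : ((N.toNat : ℕ) : ℝ) = N := by exact_mod_cast Int.toNat_of_nonneg hN0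
          rw [this]; linarith
        calc (((max N.toNat 1 : ℕ) : ℝ) ^ θ) ^ (r + 1) ≤ ((2 * H) ^ θ) ^ (r + 1) := by gcongr
          _ = (2 ^ θ * H ^ θ) ^ (r + 1) := by rw [Real.mul_rpow (by norm_num) (by positivity)]
          _ ≤ (2 ^ (1 : ℝ) * H ^ θ) ^ (r + 1) := by gcongr; norm_num
          _ = 2 ^ (r + 1) * (H ^ θ) ^ (r + 1) := by rw [Real.rpow_one, mul_pow]
          _ ≤ _ := by gcongr
      rw [siftedMoment] at h1
      have h2 : (4 : ℝ) ^ (r + 1) / Λ ≤ 4 ^ (r + 1) * Λ := by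
        rw [div_le_iff₀ hΛ0, mul_assoc]
        exact le_mul_of_one_le_right (by positivity) (by nlinarith)
      calc _ ≤ (Λ + 4 ^ (r + 1) * Λ) + 4 ^ (r + 1) / Λ * (K * (2 ^ (r + 1) * Λ ^ 2)) := by gcongr
        _ = _ := by field_simp; ring
    rw [abs_le']
    constructor
    · exact (sieveMean_mono fun T' _ => (le_abs_self _).trans (hy T')).trans hbound
    · have hneg := sieveMean_const_mul l (-1)
        (fun T' => ((T'.card : ℝ) - sieveDensity l * H) ^ ℓ) (Finset.Ico 0 N)
      rw [neg_one_mul] at hneg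
      rw [← hneg]
      refine (sieveMean_mono fun T' _ => ?_).trans hbound
      rw [neg_one_mul]
      exact (neg_le_abs _).trans (hy T')
  rw [singularMoment_eq_integral]
  have h1 := intervalIntegral.norm_integral_le_of_norm_le_const (a := H - 1) (b := H)
    (C := (1 + 4 ^ (r + 1) * (K * 2 ^ (r + 1) + 1)) * Λ)
    (f := fun u => ∑ j ∈ Finset.range (ℓ + 1),
      (ℓ.choose j : ℝ) * (-(kfreeDensity k q * H)) ^ (ℓ - j) *
        ∑ h ∈ Fintype.piFinset (fun _ : Fin j => Finset.Ico (0 : ℤ) ⌈u⌉),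
          singularSeries k q h) fun u hu => ?_
  · simpa using h1
  · rw [Set.uIoc_of_le (by linarith)] at hu
    refine hpoint ⌈u⌉ (abs_le.2 ?_)
    have := Int.le_ceil u
    have := Int.ceil_lt_add_one u
    constructor <;> linarith [hu.1, hu.2]
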